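/- Let $(M,g,J)$ be a smooth almost Hermitian manifold of real dimension $m=2n$, i.e. $g$ is a smooth Riemannian metric and $J$ a smooth almost complex structure with $g(JX,JY)=g(X,Y)$. Let $\nabla$ be the Levi-Civita connection of $g$ and $R(X,Y)Z=\nabla_X\nabla_YZ-\nabla_Y\nabla_XZ-\nabla_{[X,Y]}Z$. For a vector field $V$ and a local orthonormal frame $(e_i)_{i=1,\dots,m}$ put $\operatorname{tr}\nabla^2V=\sum_i(\nabla_{e_i}\nabla_{e_i}V-\nabla_{\nabla_{e_i}e_i}V)$, $\operatorname{Ric}V=\sum_iR(V,e_i)e_i$, $\operatorname{div}J=\sum_i(\nabla_{e_i}J)(e_i)$, and let $\sigma=J\operatorname{div}J$ and $\sigma^\flat=g(\sigma,\cdot)$. Let $T^{\mathbb C}M=T'M\oplus T''M$ be the splitting into the $\pm\mathrm i$-eigenbundles of $J$, with components written $Z=Z'+Z''$, and extend $g$ and $\nabla$ complex linearly in each argument. A Hermitian frame is a local frame $Z_j=\frac1{\sqrt2}(e_j-\mathrm iJe_j)$, $\overline Z_j$, $j=1,\dots,n$, of $T^{\mathbb C}M$ with $e_1,\dots,e_n,Je_1,\dots,Je_n$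 a smooth local orthonormal frame of $TM$; such frames exist near every point. (1) At every point of $M$, the condition $$g(\nabla_Z\sigma,W)+g(\nabla_W\sigma,Z)=g(\sigma,Z)\,g(\sigma,W)\quad\text{for all }Z,W\in T'M$$ holds if and only if $$(\mathcal L_\sigma g)(X,Y)-(\mathcal L_\sigma g)(JX,JY)=\sigma^\flat(X)\sigma^\flat(Y)-\sigma^\flat(JX)\sigma^\flat(JY)$$ for all tangent vectors $X,Y$, where $\mathcal L$ is the Lie derivative. (2) At every point of $M$, and for every Hermitian frame $\{Z_j,\overline Z_j\}$ near that point, the condition $$\Big(\operatorname{tr}\nabla^2\sigma+\operatorname{Ric}\sigma-\nabla_\sigma\sigma-2\Big(\sum_{j=1}^n\big(\nabla_{Z_j}(\nabla_{\overline Z_j}\sigma)''+\nabla_{(\nabla_{Z_j}\sigma)'}\overline Z_j\big)-\nabla_{\sigma'}\sigma''\Big)\Big)'=0$$ holds if and only if $$\operatorname{tr}\nabla^2\sigma+\operatorname{Ric}\sigma-\nabla_\sigma\sigma+\tfrac12J\big((\nabla_\sigma J)(\sigma)+(\nabla_{J\sigma}J)(J\sigma)\big)+\tfrac12\sum_{i=1}^m\Big((\nabla_{e_i}J)(D^\sigma(e_i))-(\nabla_{D^\sigma(e_i)}J)(e_i)\Big)=0,$$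 where $(e_i)$ is any orthonormal basis of the tangent space and $D^\sigma$ is the $(1,1)$-tensor field $D^\sigma(X)=\nabla_{JX}\sigma+J\nabla_X\sigma$, which is $J$-invariant: $D^\sigma(JX)=JD^\sigma(X)$. -/

import Mathlib

open Bundle FiberBundle VectorField Module
open scoped Manifold ContDiff Topology

set_option linter.unusedSectionVars false

noncomputable section
namespace LeviCivita

variable {E : Type*} [NormedAddCommGroup E] [NormedSpace ℝ E] [FiniteDimensional ℝ E]
  {H : Type*} [TopologicalSpace H] (I : ModelWithCorners ℝ E H)
  {M : Type*} [TopologicalSpace M] [ChartedSpace H M] [IsManifold I ∞ M]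
  [RiemannianBundle (fun x : M => TangentSpace I x)]

/-- The function `g(X, Y)`. -/
def ip (X Y : Π x : M, TangentSpace I x) (y : M) : ℝ := inner ℝ (X y) (Y y)

/-- The right-hand side of the Koszul formula for `2 g(∇_V X, W)` at `x`. -/
def koszul (X V W : Π x : M, TangentSpace I x) (x : M) : ℝ :=
  d% (ip I X W) x (V x) + d% (ip I V W) x (X x) - d% (ip I V X) x (W x)
    + inner ℝ (mlieBracket I V X x) (W x) - inner ℝ (mlieBracket I V W x) (X x)
    - inner ℝ (mlieBracket I X W x) (V x)

variable [IsContMDiffRiemannianBundle I ∞ E (fun x : M => TangentSpace I x)]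
variable {I}
variable {X X' V V' W W' : Π x : M, TangentSpace I x} {x : M} {f : M → ℝ}

lemma ip_mdiff (hX : MDiffAt (T% X) x) (hV : MDiffAt (T% V) x) : MDiffAt (ip I X V) x :=
  MDifferentiableAt.inner_bundle (h := inferInstance) hX hV

lemma ip_comm (X V : Π x : M, TangentSpace I x) : ip I X V = ip I V X := by
  funext y; exact real_inner_comm _ _

lemma d_ip_add (hX : MDiffAt (T% X) x) (hX' : MDiffAt (T% X') x) (hV : MDiffAt (T% V) x)
    (v : TangentSpace I x) :
    d% (ip I (X + X') V) x v = d% (ip I X V) x v + d% (ip I X' V) x v := by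
  have : ip I (X + X') V = ip I X V + ip I X' V := by
    funext y; simp [ip, inner_add_left]
  rw [this, mvfderiv_add (ip_mdiff hX hV) (ip_mdiff hX' hV)]; rfl

lemma d_ip_smul (hf : MDiffAt f x) (hX : MDiffAt (T% X) x) (hV : MDiffAt (T% V) x)
    (v : TangentSpace I x) :
    d% (ip I (f • X) V) x v = f x * d% (ip I X V) x v + d% f x v * ip I X V x := by
  have : ip I (f • X) V = f * ip I X V := by
    funext y; simp [ip, inner_smul_left]
  rw [this, mvfderiv_mul hf (ip_mdiff hX hV)]; simp; ring

lemma d_ip_add' (hX : MDiffAt (T% X) x) (hX' : MDiffAt (T% X') x) (hV : MDiffAt (T% V) x)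
    (v : TangentSpace I x) :
    d% (ip I V (X + X')) x v = d% (ip I V X) x v + d% (ip I V X') x v := by
  rw [ip_comm, d_ip_add hX hX' hV, ip_comm X, ip_comm X']

lemma d_ip_smul' (hf : MDiffAt f x) (hX : MDiffAt (T% X) x) (hV : MDiffAt (T% V) x)
    (v : TangentSpace I x) :
    d% (ip I V (f • X)) x v = f x * d% (ip I V X) x v + d% f x v * ip I V X x := by
  rw [ip_comm, d_ip_smul hf hX hV, ip_comm X]

lemma tens_left (hX : MDiffAt (T% X) x) (hW : MDiffAt (T% W) x) :
    TensorialAt I E (fun V => koszul I X V W x) x where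
  smul {f V} hf hV := by
    simp only [koszul, d_ip_smul hf hV hX, d_ip_smul hf hV hW, mlieBracket_smul_left hf hV]
    simp [inner_add_left, inner_smul_left, inner_smul_right, ip]
    rw [real_inner_comm (W x) (V x), real_inner_comm (X x) (V x)]
    ring
  add {V V'} hV hV' := by
    simp only [koszul, d_ip_add hV hV' hX, d_ip_add hV hV' hW, mlieBracket_add_left hV hV']
    simp [inner_add_left, inner_add_right]
    ring


lemma tens_right (hX : MDiffAt (T% X) x) (hV : MDiffAt (T% V) x) :
    TensorialAt I E (fun W => koszul I X V W x) x where
  smul {f W} hf hW := by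
    simp only [koszul, d_ip_smul' hf hW hX, d_ip_smul' hf hW hV, mlieBracket_smul_right hf hW]
    simp [inner_add_left, inner_smul_left, inner_smul_right, ip]
    rw [real_inner_comm (W x) (V x), real_inner_comm (X x) (W x)]
    ring
  add {W W'} hW hW' := by
    simp only [koszul, d_ip_add' hW hW' hX, d_ip_add' hW hW' hV, mlieBracket_add_right hW hW']
    simp [inner_add_left, inner_add_right]
    ring

lemma koszul_add (hX : MDiffAt (T% X) x) (hX' : MDiffAt (T% X') x) (hV : MDiffAt (T% V) x)
    (hW : MDiffAt (T% W) x) :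
    koszul I (X + X') V W x = koszul I X V W x + koszul I X' V W x := by
  simp only [koszul, d_ip_add hX hX' hW, d_ip_add' hX hX' hV, mlieBracket_add_right hX hX',
    mlieBracket_add_left hX hX']
  simp [inner_add_left, inner_add_right]
  ring

lemma koszul_smul (hf : MDiffAt f x) (hX : MDiffAt (T% X) x) (hV : MDiffAt (T% V) x)
    (hW : MDiffAt (T% W) x) :
    koszul I (f • X) V W x
      = f x * koszul I X V W x + 2 * (d% f x (V x) * inner ℝ (X x) (W x)) := by
  simp only [koszul, d_ip_smul hf hX hW, d_ip_smul' hf hX hV, mlieBracket_smul_right hf hX,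
    mlieBracket_smul_left hf hX]
  simp [inner_add_left, inner_smul_left, inner_smul_right, ip]
  rw [real_inner_comm (X x) (V x)]
  ring

/-- The Koszul expression as a bilinear form on the tangent space at `x`. -/
def koszulForm (hX : MDiffAt (T% X) x) :
    TangentSpace I x →L[ℝ] TangentSpace I x →L[ℝ] ℝ :=
  TensorialAt.mkHom₂ (fun V W => koszul I X V W x) x
    (fun _ hW => tens_left hX hW) (fun _ hV => tens_right hX hV)

lemma koszulForm_apply (hX : MDiffAt (T% X) x) (hV : MDiffAt (T% V) x) (hW : MDiffAt (T% W) x) :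
    koszulForm hX (V x) (W x) = koszul I X V W x :=
  TensorialAt.mkHom₂_apply _ _ hV hW

instance finDim (x : M) : FiniteDimensional ℝ (TangentSpace I x) :=
  inferInstanceAs (FiniteDimensional ℝ E)

instance complete (x : M) : CompleteSpace (TangentSpace I x) :=
  FiniteDimensional.complete ℝ (TangentSpace I x)

/-- The vector dual to a bilinear form with one slot filled, as a linear map. -/
def riesz (B : TangentSpace I x →L[ℝ] TangentSpace I x →L[ℝ] ℝ) :
    TangentSpace I x →L[ℝ] TangentSpace I x :=
  LinearMap.toContinuousLinearMap
    { toFun := fun v => (InnerProductSpace.toDual ℝ (TangentSpace I x)).symm (B v)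
      map_add' := fun v w => by simp
      map_smul' := fun c v => by simp }

lemma inner_riesz (B : TangentSpace I x →L[ℝ] TangentSpace I x →L[ℝ] ℝ)
    (v w : TangentSpace I x) : inner ℝ (riesz B v) w = B v w := by
  simp [riesz]

open Classical in
/-- The Koszul connection as a bare function. -/
def covFun (X : Π x : M, TangentSpace I x) (x : M) : TangentSpace I x →L[ℝ] TangentSpace I x :=
  if hX : MDiffAt (T% X) x then riesz ((1 / 2 : ℝ) • koszulForm hX) else 0

lemma inner_covFun (hX : MDiffAt (T% X) x) (hV : MDiffAt (T% V) x) (hW : MDiffAt (T% W) x) :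
    inner ℝ (covFun X x (V x)) (W x) = (1 / 2 : ℝ) * koszul I X V W x := by
  rw [covFun, dif_pos hX, inner_riesz]
  simp [koszulForm_apply hX hV hW]

lemma ext_clm {A B : TangentSpace I x →L[ℝ] TangentSpace I x}
    (h : ∀ V W : Π x : M, TangentSpace I x, MDiffAt (T% V) x → MDiffAt (T% W) x →
      inner ℝ (A (V x)) (W x) = inner ℝ (B (V x)) (W x)) : A = B := by
  ext v
  refine ext_inner_right ℝ fun w => ?_
  simpa using h (extend E v) (extend E w) (mdifferentiableAt_extend ..)
    (mdifferentiableAt_extend ..)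

variable (I M) in
/-- The Levi-Civita connection of the Riemannian metric. -/
def _root_.leviCivita : CovariantDerivative I E (TangentSpace I : M → Type _) where
  toFun := covFun
  isCovariantDerivativeOnUniv :=
    { add := fun {X X' x} hX hX' _ => by
        refine ext_clm fun V W hV hW => ?_
        rw [inner_covFun (mdifferentiableAt_add_section hX hX') hV hW,
          koszul_add hX hX' hV hW]
        simp [inner_add_left, inner_covFun, hX, hX', hV, hW]
        ring
      leibniz := fun {X f x} hX hf _ => by
        refine ext_clm fun V W hV hW => ?_
        rw [inner_covFun (hf.smul_section hX) hV hW, koszul_smul hf hX hV hW]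
        simp [inner_add_left, inner_smul_left, inner_covFun, hX, hV, hW]
        ring }

/-- The connection is torsion-free. -/
theorem torsion_eq_zero : (leviCivita I M).torsion = 0 := by
  rw [CovariantDerivative.torsion_eq_zero_iff]
  intro V X x hV hX
  refine ext_inner_right ℝ fun w => ?_
  have hW : MDiffAt (T% (extend E w)) x := mdifferentiableAt_extend ..
  have h1 := inner_covFun hX hV hW
  have h2 := inner_covFun hV hX hW
  simp only [extend_apply_self] at h1 h2
  rw [inner_sub_left]
  refine (congrArg₂ (· - ·) h1 h2).trans ?_
  simp only [koszul, ip_comm X V, mlieBracket_swap_apply (V := X) (W := V)]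
  simp
  ring

/-- The connection is compatible with the metric: `v (g(X, W)) = g(∇_v X, W) + g(X, ∇_v W)`. -/
theorem d_inner_eq (hX : MDiffAt (T% X) x) (hW : MDiffAt (T% W) x) (v : TangentSpace I x) :
    d% (ip I X W) x v
      = inner ℝ (leviCivita I M X x v) (W x) + inner ℝ (X x) (leviCivita I M W x v) := by
  have hV : MDiffAt (T% (extend E v)) x := mdifferentiableAt_extend ..
  have h1 := inner_covFun hX hV hW
  have h2 := inner_covFun hW hV hX
  rw [real_inner_comm] at h2
  simp only [extend_apply_self] at h1 h2
  refine Eq.trans ?_ (congrArg₂ (· + ·) h1 h2).symm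
  simp only [koszul, ip_comm W X, mlieBracket_swap_apply (V := W) (W := X)]
  simp
  ring

end LeviCivita

/-! ### Tensor calculus on a Riemannian manifold -/

section Riemannian

variable {E : Type*} [NormedAddCommGroup E] [NormedSpace ℝ E] [FiniteDimensional ℝ E]
  {H : Type*} [TopologicalSpace H] {I : ModelWithCorners ℝ E H}
  {M : Type*} [TopologicalSpace M] [ChartedSpace H M] [IsManifold I ∞ M]
  [RiemannianBundle (fun x : M => TangentSpace I x)]
  [IsContMDiffRiemannianBundle I ∞ E (fun x : M => TangentSpace I x)]

/-- `covDeriv Y x v = ∇_v Y` at `x`, for the Levi-Civita connection `∇`. -/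
def covDeriv (Y : Π x : M, TangentSpace I x) (x : M) : TangentSpace I x →L[ℝ] TangentSpace I x :=
  leviCivita I M Y x

/-- `tr B = ∑ i, B(e_i, e_i)` over an orthonormal basis `e_i` of the tangent space at `x`. -/
def metricTrace (x : M) (B : TangentSpace I x → TangentSpace I x → TangentSpace I x) :
    TangentSpace I x :=
  ∑ i, B (stdOrthonormalBasis ℝ (TangentSpace I x) i) (stdOrthonormalBasis ℝ (TangentSpace I x) i)

/-- The second covariant derivative `∇²_{u,v} Y = ∇_u ∇_v Y - ∇_{∇_u v} Y` at `x`; here, as in the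
next definitions, tangent vectors are extended to vector fields which are smooth near `x`. -/
def secondCovDeriv (Y : Π x : M, TangentSpace I x) (x : M) (u v : TangentSpace I x) :
    TangentSpace I x :=
  covDeriv (fun y => covDeriv Y y (extend E v y)) x u
    - covDeriv Y x (covDeriv (extend E v) x u)

/-- The curvature `R(u, v)w = ∇_u ∇_v w - ∇_v ∇_u w - ∇_{[u, v]} w` at `x`. -/
def curvature (x : M) (u v w : TangentSpace I x) : TangentSpace I x :=
  covDeriv (fun y => covDeriv (extend E w) y (extend E v y)) x u
    - covDeriv (fun y => covDeriv (extend E w) y (extend E u y)) x v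
    - covDeriv (extend E w) x (mlieBracket I (extend E u) (extend E v) x)

/-- The rough Laplacian `tr ∇² Y`. -/
def roughLaplacian (Y : Π x : M, TangentSpace I x) (x : M) : TangentSpace I x :=
  metricTrace x (secondCovDeriv Y x)

/-- The Ricci operator `Ric u = ∑ i, R(u, e_i) e_i`. -/
def ricciOp (x : M) (u : TangentSpace I x) : TangentSpace I x :=
  metricTrace x (fun v w => curvature x u v w)

/-- The Lie derivative of the metric,
`(L_Y g)(u, v) = Y (g(u, v)) - g([Y, u], v) - g(u, [Y, v])` at `x`. -/
def lieDerivMetric (Y : Π x : M, TangentSpace I x) (x : M) (u v : TangentSpace I x) : ℝ :=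
  d% (fun y => (inner ℝ (extend E u y) (extend E v y) : ℝ)) x (Y x)
    - inner ℝ (mlieBracket I Y (extend E u) x) v
    - inner ℝ u (mlieBracket I Y (extend E v) x)

/-- The one-form `Y♭ = g(Y, ·)`. -/
def flat (Y : Π x : M, TangentSpace I x) (x : M) (v : TangentSpace I x) : ℝ :=
  inner ℝ (Y x) v

/-- `(∇_u J)(v) = ∇_u (J v) - J (∇_u v)` at `x`. -/
def covDerivEnd (J : Π x : M, TangentSpace I x →L[ℝ] TangentSpace I x) (x : M)
    (u v : TangentSpace I x) : TangentSpace I x :=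
  covDeriv (fun y => J y (extend E v y)) x u - J x (covDeriv (extend E v) x u)

/-- The divergence `div J = ∑ i, (∇_{e_i} J)(e_i)`. -/
def divEnd (J : Π x : M, TangentSpace I x →L[ℝ] TangentSpace I x) (x : M) : TangentSpace I x :=
  metricTrace x (covDerivEnd J x)

/-- The vector field `σ = J div J`. -/
def sigmaField (J : Π x : M, TangentSpace I x →L[ℝ] TangentSpace I x) (x : M) :
    TangentSpace I x :=
  J x (divEnd J x)

/-- `J` is a smooth almost complex structure for which the metric is Hermitian. -/
structure IsAlmostHermitian (J : Π x : M, TangentSpace I x →L[ℝ] TangentSpace I x) : Prop where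
  smooth : ContMDiff I (I.prod 𝓘(ℝ, E →L[ℝ] E)) ∞
    (fun x => (⟨x, J x⟩ : TotalSpace (E →L[ℝ] E)
      (fun x : M => TangentSpace I x →L[ℝ] TangentSpace I x)))
  sq : ∀ (x : M) (v : TangentSpace I x), J x (J x v) = -v
  inner_map : ∀ (x : M) (v w : TangentSpace I x), inner ℝ (J x v) (J x w) = inner ℝ v w

/-! ### The complexified tangent bundle -/

variable (I) in
/-- The complexified tangent space at `x`: the pair `(a, b)` stands for `a + i b`. -/
abbrev CTangent (x : M) : Type _ := TangentSpace I x × TangentSpace I x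

/-- A real vector as a complex one. -/
def toC {x : M} (v : TangentSpace I x) : CTangent I x := (v, 0)

/-- Complex conjugation. -/
def conjC {x : M} (Z : CTangent I x) : CTangent I x := (Z.1, -Z.2)

/-- Multiplication by `i`. -/
def mulI {x : M} (Z : CTangent I x) : CTangent I x := (-Z.2, Z.1)

/-- The complex linear extension of `J`. -/
def mapC (J : Π x : M, TangentSpace I x →L[ℝ] TangentSpace I x) {x : M} (Z : CTangent I x) :
    CTangent I x :=
  (J x Z.1, J x Z.2)

/-- The complex bilinear extension of the metric. -/
def gC {x : M} (Z W : CTangent I x) : ℂ :=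
  ⟨inner ℝ Z.1 W.1 - inner ℝ Z.2 W.2, inner ℝ Z.1 W.2 + inner ℝ Z.2 W.1⟩

/-- `covC Y x Z = ∇_Z Y` at `x`, the complex bilinear extension of the Levi-Civita connection. -/
def covC (Y : Π x : M, CTangent I x) (x : M) (Z : CTangent I x) : CTangent I x :=
  (covDeriv (fun y => (Y y).1) x Z.1 - covDeriv (fun y => (Y y).2) x Z.2,
    covDeriv (fun y => (Y y).2) x Z.1 + covDeriv (fun y => (Y y).1) x Z.2)

/-- Membership in `T'M`, the eigenspace of `J` for the eigenvalue `i`. -/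
def MemHol (J : Π x : M, TangentSpace I x →L[ℝ] TangentSpace I x) {x : M} (Z : CTangent I x) :
    Prop :=
  mapC J Z = mulI Z

/-- The component `Z' = (Z - i J Z) / 2` of `Z` in `T'M`. -/
def holPart (J : Π x : M, TangentSpace I x →L[ℝ] TangentSpace I x) {x : M} (Z : CTangent I x) :
    CTangent I x :=
  (1 / 2 : ℝ) • (Z - mulI (mapC J Z))

/-- The component `Z'' = (Z + i J Z) / 2` of `Z` in `T''M`. -/
def antiPart (J : Π x : M, TangentSpace I x →L[ℝ] TangentSpace I x) {x : M} (Z : CTangent I x) :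
    CTangent I x :=
  (1 / 2 : ℝ) • (Z + mulI (mapC J Z))

/-- `e_1, …, e_n` are smooth vector fields on the open set `U` such that
`e_1, …, e_n, J e_1, …, J e_n` is an orthonormal frame of the tangent bundle on `U`. -/
structure IsHermitianFrameOn (J : Π x : M, TangentSpace I x →L[ℝ] TangentSpace I x)
    {n : ℕ} (e : Fin n → Π x : M, TangentSpace I x) (U : Set M) : Prop where
  isOpen : IsOpen U
  dim : Module.finrank ℝ E = 2 * n
  smooth : ∀ j, ContMDiffOn I I.tangent ∞ (fun y => (⟨y, e j y⟩ : TangentBundle I M)) U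
  orthonormal : ∀ y ∈ U, Orthonormal ℝ (Sum.elim (fun j => e j y) (fun j => J y (e j y)))

/-- The vector field `Z_j = (e_j - i J e_j) / √2` of the Hermitian frame; its conjugate is
`Z_{\bar j}`. -/
def frameZ (J : Π x : M, TangentSpace I x →L[ℝ] TangentSpace I x)
    {n : ℕ} (e : Fin n → Π x : M, TangentSpace I x) (j : Fin n) (x : M) : CTangent I x :=
  (1 / √2 : ℝ) • ((e j x, -J x (e j x)) : CTangent I x)

/-! ### The two conditions, in complex and in real form -/

/-- The first condition at `x`:
`g(∇_Z σ, W) + g(∇_W σ, Z) = g(σ, Z) g(σ, W)` for all `Z`, `W` in `T'M`. -/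
def ComplexCondOne (J : Π x : M, TangentSpace I x →L[ℝ] TangentSpace I x) (x : M) : Prop :=
  ∀ Z W : CTangent I x, MemHol J Z → MemHol J W →
    gC (covC (fun y => toC (sigmaField J y)) x Z) W
      + gC (covC (fun y => toC (sigmaField J y)) x W) Z
      = gC (toC (sigmaField J x)) Z * gC (toC (sigmaField J x)) W

/-- The second condition at `x`, in terms of a Hermitian frame `Z_j` near `x`:
the `T'M`-component of `tr ∇² σ + Ric σ - ∇_σ σ
- 2 (∑ j, (∇_{Z_j} (∇_{\bar Z_j} σ)'' + ∇_{(∇_{Z_j} σ)'} \bar Z_j) - ∇_{σ'} σ'')` is zero. -/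
def ComplexCondTwo (J : Π x : M, TangentSpace I x →L[ℝ] TangentSpace I x)
    {n : ℕ} (e : Fin n → Π x : M, TangentSpace I x) (x : M) : Prop :=
  let σ : Π x : M, TangentSpace I x := sigmaField J
  let σC : Π x : M, CTangent I x := fun y => toC (σ y)
  holPart J
    (toC (roughLaplacian σ x + ricciOp x (σ x) - covDeriv σ x (σ x))
      - (2 : ℝ) •
        ((∑ j, (covC (fun y => antiPart J (covC σC y (conjC (frameZ J e j y)))) x (frameZ J e j x)
            + covC (fun y => conjC (frameZ J e j y)) x
                (holPart J (covC σC x (frameZ J e j x)))))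
          - covC (fun y => antiPart J (σC y)) x (holPart J (σC x)))) = 0

/-- The first condition at `x` on the real tangent bundle. -/
def RealCondOne (J : Π x : M, TangentSpace I x →L[ℝ] TangentSpace I x) (x : M) : Prop :=
  ∀ X Y : TangentSpace I x,
    lieDerivMetric (sigmaField J) x X Y - lieDerivMetric (sigmaField J) x (J x X) (J x Y)
      = flat (sigmaField J) x X * flat (sigmaField J) x Y
        - flat (sigmaField J) x (J x X) * flat (sigmaField J) x (J x Y)

/-- The tensor field `D^Y(X) = ∇_{JX} Y + J ∇_X Y`. -/
def tensorD (J : Π x : M, TangentSpace I x →L[ℝ] TangentSpace I x)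
    (Y : Π x : M, TangentSpace I x) (x : M) : TangentSpace I x →L[ℝ] TangentSpace I x :=
  covDeriv Y x ∘L J x + J x ∘L covDeriv Y x

/-- The second condition at `x` on the real tangent bundle. -/
def RealCondTwo (J : Π x : M, TangentSpace I x →L[ℝ] TangentSpace I x) (x : M) : Prop :=
  let σ : Π x : M, TangentSpace I x := sigmaField J
  let D : TangentSpace I x →L[ℝ] TangentSpace I x := tensorD J σ x
  roughLaplacian σ x + ricciOp x (σ x) - covDeriv σ x (σ x)
    + (1 / 2 : ℝ) • J x (covDerivEnd J x (σ x) (σ x) + covDerivEnd J x (J x (σ x)) (J x (σ x)))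
    + (1 / 2 : ℝ) • metricTrace x
        (fun u v => covDerivEnd J x u (D v) - covDerivEnd J x (D u) v) = 0

end Riemannian

end

noncomputable section AlmostHermitian

variable {E : Type*} [NormedAddCommGroup E] [NormedSpace ℝ E] [FiniteDimensional ℝ E]
  {H : Type*} [TopologicalSpace H] {I : ModelWithCorners ℝ E H}
  {M : Type*} [TopologicalSpace M] [ChartedSpace H M] [IsManifold I ∞ M]
  [RiemannianBundle (fun x : M => TangentSpace I x)]
  [IsContMDiffRiemannianBundle I ∞ E (fun x : M => TangentSpace I x)]
  {J : Π x : M, TangentSpace I x →L[ℝ] TangentSpace I x}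
  {X Y V W : Π x : M, TangentSpace I x} {U : Set M} {x : M}

/-! ### Orthogonal complex structures -/

namespace IsAlmostHermitian

lemma inner_left (hJ : IsAlmostHermitian J) (v w : TangentSpace I x) :
    inner ℝ (J x v) w = -inner ℝ v (J x w) := by
  rw [← hJ.inner_map x v (J x w), hJ.sq, inner_neg_right, neg_neg]

lemma inner_self_map (hJ : IsAlmostHermitian J) (v : TangentSpace I x) :
    inner ℝ v (J x v) = 0 := by
  have := hJ.inner_left v v
  rw [real_inner_comm] at this
  linarith

lemma orthonormal_iff (hJ : IsAlmostHermitian J) {n : ℕ} (e : Fin n → TangentSpace I x) :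
    Orthonormal ℝ (Sum.elim e (fun j => J x (e j))) ↔
      (∀ i j, inner ℝ (e i) (e j) = if i = j then 1 else 0) ∧
        ∀ i j, inner ℝ (e i) (J x (e j)) = 0 := by
  rw [orthonormal_iff_ite]
  constructor
  · intro h
    refine ⟨fun i j => ?_, fun i j => ?_⟩
    · simpa using h (.inl i) (.inl j)
    · simpa using h (.inl i) (.inr j)
  · rintro ⟨h1, h2⟩ (i | i) (j | j)
    · simpa using h1 i j
    · simpa using h2 i j
    · simpa [real_inner_comm] using h2 j i
    · simpa [hJ.inner_map] using h1 i j

lemma contMDiffOn_apply (hJ : IsAlmostHermitian J) (hX : CMDiff[U] ∞ (T% X)) :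
    CMDiff[U] ∞ (T% (fun y => J y (X y))) :=
  ContMDiffOn.clm_bundle_apply hJ.smooth.contMDiffOn hX

lemma mdifferentiableAt_apply (hJ : IsAlmostHermitian J) (hX : MDiffAt (T% X) x) :
    MDiffAt (T% (fun y => J y (X y))) x :=
  MDifferentiableAt.clm_bundle_apply (hJ.smooth.mdifferentiableAt (by simp)) hX

end IsAlmostHermitian

lemma contMDiffOn_inner (hX : CMDiff[U] ∞ (T% X)) (hY : CMDiff[U] ∞ (T% Y)) :
    CMDiff[U] ∞ (fun y => (inner ℝ (X y) (Y y) : ℝ)) :=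
  ContMDiffOn.inner_bundle hX hY

/-! ### Hermitian frames -/

/-- A partial Hermitian frame which does not yet span can be extended by one more vector field. -/
lemma IsAlmostHermitian.exists_cons_frame (hJ : IsAlmostHermitian J) {k : ℕ}
    {e : Fin k → Π x : M, TangentSpace I x} (hU : IsOpen U) (hx : x ∈ U)
    (he : ∀ j, CMDiff[U] ∞ (T% (e j)))
    (ho : ∀ y ∈ U, Orthonormal ℝ (Sum.elim (fun j => e j y) (fun j => J y (e j y))))
    (hk : finrank ℝ E ≠ 2 * k) :
    ∃ (e' : Fin (k + 1) → Π x : M, TangentSpace I x) (U' : Set M), IsOpen U' ∧ x ∈ U' ∧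
      (∀ j, CMDiff[U'] ∞ (T% (e' j))) ∧
      ∀ y ∈ U', Orthonormal ℝ (Sum.elim (fun j => e' j y) (fun j => J y (e' j y))) := by
  obtain ⟨v, hv, hv0⟩ : ∃ v ∈ (Submodule.span ℝ (Set.range
      (Sum.elim (fun j => e j x) (fun j => J x (e j x)))))ᗮ, v ≠ 0 := by
    refine Submodule.exists_mem_ne_zero_of_ne_bot fun hbot => hk ?_
    have htop := (Submodule.orthogonal_eq_bot_iff).1 hbot
    have h1 := finrank_span_eq_card (ho x hx).linearIndependent
    rw [htop, finrank_top] at h1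
    rw [two_mul]
    simpa using (show finrank ℝ E = _ from h1)
  have hvl (j : Fin k) : inner ℝ (e j x) v = 0 :=
    Submodule.inner_right_of_mem_orthogonal (Submodule.subset_span (Set.mem_range_self (Sum.inl j))) hv
  have hvr (j : Fin k) : inner ℝ (J x (e j x)) v = 0 :=
    Submodule.inner_right_of_mem_orthogonal (Submodule.subset_span (Set.mem_range_self (Sum.inr j))) hv
  obtain ⟨s, hs, hYs⟩ := exists_contMDiffOn_extend (k := ∞) I E v
  obtain ⟨t, hts, ht, hxt⟩ := mem_nhds_iff.1 hs
  set Y : Π x : M, TangentSpace I x := extend E v with hYdef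
  have hY : CMDiff[U ∩ t] ∞ (T% Y) := hYs.mono (Set.inter_subset_right.trans hts)
  have he' (j) : CMDiff[U ∩ t] ∞ (T% (e j)) := (he j).mono Set.inter_subset_left
  have hJe (j) : CMDiff[U ∩ t] ∞ (T% (fun y => J y (e j y))) := hJ.contMDiffOn_apply (he' j)
  let P : Π x : M, TangentSpace I x := fun y =>
    ∑ j, (inner ℝ (e j y) (Y y) • e j y + inner ℝ (J y (e j y)) (Y y) • J y (e j y))
  have hP : CMDiff[U ∩ t] ∞ (T% P) := by
    refine ContMDiffOn.sum_section fun j _ => ?_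
    exact ((contMDiffOn_inner (he' j) hY).smul_section (he' j)).add_section
      ((contMDiffOn_inner (hJe j) hY).smul_section (hJe j))
  let W : Π x : M, TangentSpace I x := Y - P
  have hW : CMDiff[U ∩ t] ∞ (T% W) := hY.sub_section hP
  have hWW : CMDiff[U ∩ t] ∞ (fun y => (inner ℝ (W y) (W y) : ℝ)) :=
    contMDiffOn_inner hW hW
  have hPx : P x = 0 := by
    refine Finset.sum_eq_zero fun j _ => ?_
    simp [hYdef, hvl, hvr]
  have hWx : W x = v := by simp [W, hPx, hYdef]
  have hWo (y) (hy : y ∈ U ∩ t) (i : Fin k) :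
      inner ℝ (e i y) (W y) = 0 ∧ inner ℝ (J y (e i y)) (W y) = 0 := by
    obtain ⟨h1, h2⟩ := (hJ.orthonormal_iff _).1 (ho y hy.1)
    have h3 (i j) : inner ℝ (J y (e i y)) (e j y) = 0 := by rw [real_inner_comm]; exact h2 j i
    constructor
    · simp [W, P, inner_sub_right, inner_sum, inner_add_right, inner_smul_right, h1, h2]
    · simp [W, P, inner_sub_right, inner_sum, inner_add_right, inner_smul_right, h1, h3,
        hJ.inner_map]
  let U' : Set M := (U ∩ t) ∩ (fun y => (inner ℝ (W y) (W y) : ℝ)) ⁻¹' (Set.Ioi 0)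
  have hU' : IsOpen U' := hWW.continuousOn.isOpen_inter_preimage (hU.inter ht) isOpen_Ioi
  have hxU' : x ∈ U' := ⟨⟨hx, hxt⟩, by
    simp only [Set.mem_preimage, hWx, Set.mem_Ioi]
    exact real_inner_self_pos.2 hv0⟩
  let c : M → ℝ := fun y => (√(inner ℝ (W y) (W y)))⁻¹
  have hc : CMDiff[U'] ∞ c := by
    intro y hy
    have h0 : (inner ℝ (W y) (W y) : ℝ) ≠ 0 := ne_of_gt hy.2
    have h1 : ContDiffAt ℝ ∞ (fun r : ℝ => (√r)⁻¹) (inner ℝ (W y) (W y)) :=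
      (Real.contDiffAt_sqrt h0).inv (Real.sqrt_ne_zero'.2 hy.2)
    exact ContMDiffAt.comp_contMDiffWithinAt (I' := 𝓘(ℝ, ℝ))
      (g := fun r : ℝ => (√r)⁻¹) y h1.contMDiffAt
      ((hWW y hy.1).mono Set.inter_subset_left)
  have hcW : CMDiff[U'] ∞ (T% (c • W)) := hc.smul_section (hW.mono Set.inter_subset_left)
  refine ⟨Fin.cons (c • W) e, U', hU', hxU', ?_, fun y hy => ?_⟩
  · refine Fin.cases ?_ fun j => ?_
    · simpa using hcW
    · simpa using (he j).mono (Set.inter_subset_left.trans Set.inter_subset_left)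
  · obtain ⟨h1, h2⟩ := (hJ.orthonormal_iff _).1 (ho y hy.1.1)
    have h3 (i) : inner ℝ (W y) (e i y) = 0 := by rw [real_inner_comm]; exact (hWo y hy.1 i).1
    have h4 (i) : inner ℝ (e i y) (J y (W y)) = 0 := by
      have := hJ.inner_left (e i y) (W y)
      rw [(hWo y hy.1 i).2] at this
      linarith
    have h5 (i) : inner ℝ (W y) (J y (e i y)) = 0 := by
      rw [real_inner_comm]; exact (hWo y hy.1 i).2
    have hcc : c y * (c y * inner ℝ (W y) (W y)) = 1 := by
      have hpos : 0 < (inner ℝ (W y) (W y) : ℝ) := hy.2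
      have hs := Real.mul_self_sqrt hpos.le
      have hs0 := (Real.sqrt_pos.2 hpos).ne'
      simp only [c]
      field_simp
      nlinarith
    rw [hJ.orthonormal_iff]
    constructor
    · refine Fin.cases (Fin.cases ?_ fun j => ?_) fun i => Fin.cases ?_ fun j => ?_
      · simpa [inner_smul_left, inner_smul_right, -inner_self_eq_norm_sq_to_K] using hcc
      · simp [inner_smul_left, h3, (Fin.succ_ne_zero j).symm]
      · simp [inner_smul_right, (hWo y hy.1 i).1, Fin.succ_ne_zero i]
      · simpa using h1 i j
    · refine Fin.cases (Fin.cases ?_ fun j => ?_) fun i => Fin.cases ?_ fun j => ?_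
      · simp [inner_smul_left, inner_smul_right, hJ.inner_self_map]
      · simp [inner_smul_left, h5]
      · simp [inner_smul_right, h4]
      · simpa using h2 i j

/-- Hermitian frames exist near every point. -/
lemma IsAlmostHermitian.exists_hermitianFrame (hJ : IsAlmostHermitian J) (x : M) :
    ∃ (n : ℕ) (e : Fin n → Π x : M, TangentSpace I x) (U : Set M),
      x ∈ U ∧ IsHermitianFrameOn J e U := by
  by_contra hno
  have key (k : ℕ) : ∃ (e : Fin k → Π x : M, TangentSpace I x) (U : Set M), IsOpen U ∧ x ∈ U ∧
      (∀ j, CMDiff[U] ∞ (T% (e j))) ∧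
      ∀ y ∈ U, Orthonormal ℝ (Sum.elim (fun j => e j y) (fun j => J y (e j y))) := by
    induction k with
    | zero =>
      refine ⟨Fin.elim0, Set.univ, isOpen_univ, trivial, fun j => j.elim0, fun y _ => ?_⟩
      rw [hJ.orthonormal_iff]
      exact ⟨fun i => i.elim0, fun i => i.elim0⟩
    | succ k ih =>
      obtain ⟨e, U, hU, hx, he, ho⟩ := ih
      refine hJ.exists_cons_frame hU hx he ho fun hk => hno ⟨k, e, U, hx, hU, hk, he, ho⟩
  obtain ⟨e, U, -, hx, -, ho⟩ := key (finrank ℝ E + 1)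
  have h : Fintype.card (Fin (finrank ℝ E + 1) ⊕ Fin (finrank ℝ E + 1)) ≤ finrank ℝ E :=
    (ho x hx).linearIndependent.fintype_card_le_finrank
  simp at h
  omega

namespace IsHermitianFrameOn

variable {n : ℕ} {e : Fin n → Π x : M, TangentSpace I x}

/-- The orthonormal basis `e_1, …, e_n, J e_1, …, J e_n` of the tangent space. -/
def basis (he : IsHermitianFrameOn J e U) (hx : x ∈ U) :
    OrthonormalBasis (Fin n ⊕ Fin n) ℝ (TangentSpace I x) :=
  OrthonormalBasis.mk (he.orthonormal x hx) (by
    rw [(he.orthonormal x hx).linearIndependent.span_eq_top_of_card_eq_finrank' ?_]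
    rw [show finrank ℝ (TangentSpace I x) = 2 * n from he.dim]
    simp [two_mul])

lemma basis_inl (he : IsHermitianFrameOn J e U) (hx : x ∈ U) (j : Fin n) :
    he.basis hx (.inl j) = e j x := by
  simp [basis]

lemma basis_inr (he : IsHermitianFrameOn J e U) (hx : x ∈ U) (j : Fin n) :
    he.basis hx (.inr j) = J x (e j x) := by
  simp [basis]

lemma sum_inner_smul (he : IsHermitianFrameOn J e U) (hx : x ∈ U) (v : TangentSpace I x) :
    v = ∑ j, ((inner ℝ v (e j x) : ℝ) • e j x
      + (inner ℝ v (J x (e j x)) : ℝ) • J x (e j x)) := by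
  conv_lhs => rw [← (he.basis hx).sum_repr' v]
  simp only [Fintype.sum_sum_type, basis_inl, basis_inr, Finset.sum_add_distrib]
  simp only [real_inner_comm v]

/-- A vector field is smooth if its inner products with smooth vector fields are. -/
lemma contMDiffOn_of_inner (hJ : IsAlmostHermitian J) (he : IsHermitianFrameOn J e U)
    (h : ∀ W : Π x : M, TangentSpace I x, CMDiff[U] ∞ (T% W) →
      CMDiff[U] ∞ (fun y => (inner ℝ (X y) (W y) : ℝ))) :
    CMDiff[U] ∞ (T% X) := by
  have hs : CMDiff[U] ∞ (T% (fun y => ∑ j, ((inner ℝ (X y) (e j y) : ℝ) • e j y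
      + (inner ℝ (X y) (J y (e j y)) : ℝ) • J y (e j y)))) := by
    refine ContMDiffOn.sum_section fun j _ => ?_
    have hj := hJ.contMDiffOn_apply (he.smooth j)
    exact ((h _ (he.smooth j)).smul_section (he.smooth j)).add_section
      ((h _ hj).smul_section hj)
  refine hs.congr fun y hy => ?_
  rw [← he.sum_inner_smul hy]

end IsHermitianFrameOn

/-! ### Smoothness of covariant derivatives -/

/-- The derivative of a smooth function along a smooth vector field is smooth. -/
lemma contMDiffOn_mvfderiv_apply {f : M → ℝ} (hU : IsOpen U) (hf : CMDiff[U] ∞ f)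
    (hV : CMDiff[U] ∞ (T% V)) : CMDiff[U] ∞ (fun y => (d% f y (V y) : ℝ)) := by
  have h1 := hf.contMDiffOn_tangentMapWithin (m := ∞) (by simp) hU.uniqueMDiffOn
  have h2 := h1.comp hV (fun y hy => hy)
  have h3 := (contMDiff_snd_tangentBundle_modelSpace (n := ∞) ℝ 𝓘(ℝ, ℝ)).comp_contMDiffOn h2
  refine h3.congr fun y hy => ?_
  simp only [Function.comp, tangentMapWithin, mfderivWithin_of_isOpen hU hy]
  rfl

lemma contMDiffOn_mlieBracket (hU : IsOpen U) (hV : CMDiff[U] ∞ (T% V))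
    (hW : CMDiff[U] ∞ (T% W)) : CMDiff[U] ∞ (T% (mlieBracket I V W)) := by
  intro y hy
  have : IsManifold I (minSmoothness ℝ 2) M := by
    rw [minSmoothness_of_isRCLikeNormedField]
    infer_instance
  have : IsManifold I (((⊤ : ℕ∞) : WithTop ℕ∞) + 1) M := by
    simpa using ‹IsManifold I ∞ M›
  have h := ContMDiffAt.mlieBracket_vectorField (m := ⊤) (n := ⊤) (I := I)
    (hV.contMDiffAt (hU.mem_nhds hy)) (hW.contMDiffAt (hU.mem_nhds hy)) (by simp)
  exact h.contMDiffWithinAt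

lemma contMDiffOn_koszul (hU : IsOpen U) (hX : CMDiff[U] ∞ (T% X)) (hV : CMDiff[U] ∞ (T% V))
    (hW : CMDiff[U] ∞ (T% W)) : CMDiff[U] ∞ (LeviCivita.koszul I X V W) := by
  have d {A B C : Π x : M, TangentSpace I x} (hA : CMDiff[U] ∞ (T% A)) (hB : CMDiff[U] ∞ (T% B))
      (hC : CMDiff[U] ∞ (T% C)) :
      CMDiff[U] ∞ (fun y => (d% (LeviCivita.ip I A B) y (C y) : ℝ)) :=
    contMDiffOn_mvfderiv_apply hU (contMDiffOn_inner hA hB) hC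
  have b {A B C : Π x : M, TangentSpace I x} (hA : CMDiff[U] ∞ (T% A)) (hB : CMDiff[U] ∞ (T% B))
      (hC : CMDiff[U] ∞ (T% C)) :
      CMDiff[U] ∞ (fun y => (inner ℝ (mlieBracket I A B y) (C y) : ℝ)) :=
    contMDiffOn_inner (contMDiffOn_mlieBracket hU hA hB) hC
  exact (((((d hX hW hV).add (d hV hW hX)).sub (d hV hX hW)).add (b hV hX hW)).sub
    (b hV hW hX)).sub (b hX hW hV)

lemma mdifferentiableAt_of_contMDiffOn (hU : IsOpen U) (hX : CMDiff[U] ∞ (T% X)) (hx : x ∈ U) :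
    MDiffAt (T% X) x :=
  (hX.contMDiffAt (hU.mem_nhds hx)).mdifferentiableAt (by simp)

lemma IsHermitianFrameOn.contMDiffOn_covDeriv {n : ℕ} {e : Fin n → Π x : M, TangentSpace I x}
    (hJ : IsAlmostHermitian J) (he : IsHermitianFrameOn J e U)
    (hX : CMDiff[U] ∞ (T% X)) (hV : CMDiff[U] ∞ (T% V)) :
    CMDiff[U] ∞ (T% (fun y => covDeriv X y (V y))) := by
  refine he.contMDiffOn_of_inner hJ fun W hW => ?_
  refine (ContMDiffOn.mul (contMDiffOn_const (c := (1 / 2 : ℝ)))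
    (contMDiffOn_koszul he.isOpen hX hV hW)).congr fun y hy => ?_
  exact LeviCivita.inner_covFun (mdifferentiableAt_of_contMDiffOn he.isOpen hX hy)
    (mdifferentiableAt_of_contMDiffOn he.isOpen hV hy) (mdifferentiableAt_of_contMDiffOn he.isOpen hW hy)

/-! ### Algebraic rules for the covariant derivative -/

lemma covDeriv_add (hX : MDiffAt (T% X) x) (hY : MDiffAt (T% Y) x) :
    covDeriv (X + Y) x = covDeriv X x + covDeriv Y x :=
  (leviCivita I M).isCovariantDerivativeOnUniv.add hX hY

lemma covDeriv_const_smul (c : ℝ) (hX : MDiffAt (T% X) x) :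
    covDeriv (fun y => c • X y) x = c • covDeriv X x :=
  (leviCivita I M).isCovariantDerivativeOnUniv.smul_const c hX

lemma covDeriv_neg (hX : MDiffAt (T% X) x) :
    covDeriv (fun y => -X y) x = -covDeriv X x := by
  simpa using covDeriv_const_smul (-1) hX

lemma covDeriv_zero : covDeriv (fun y : M => (0 : TangentSpace I y)) x = 0 :=
  (leviCivita I M).isCovariantDerivativeOnUniv.zero

lemma covDeriv_smul {f : M → ℝ} (hf : MDiffAt f x) (hX : MDiffAt (T% X) x)
    (u : TangentSpace I x) :
    covDeriv (f • X) x u = f x • covDeriv X x u + (d% f x u : ℝ) • X x := by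
  have := (leviCivita I M).isCovariantDerivativeOnUniv.leibniz hX hf
  exact congrArg (fun A => A u) this

/-! ### The derivative of the almost complex structure -/

namespace IsAlmostHermitian

lemma tensorialAt_covDerivEnd (hJ : IsAlmostHermitian J) (u : TangentSpace I x) :
    TensorialAt I E (fun X : Π x : M, TangentSpace I x =>
      covDeriv (fun y => J y (X y)) x u - J x (covDeriv X x u)) x where
  smul {f X} hf hX := by
    have h : (fun y => J y ((f • X) y)) = f • (fun y => J y (X y)) := by
      funext y
      simp
    simp only [h, covDeriv_smul hf hX, covDeriv_smul hf (hJ.mdifferentiableAt_apply hX)]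
    simp only [map_add, map_smul]
    module
  add {X Y} hX hY := by
    have h : (fun y => J y ((X + Y) y)) = (fun y => J y (X y)) + (fun y => J y (Y y)) := by
      funext y
      simp
    simp only [h, covDeriv_add hX hY,
      covDeriv_add (hJ.mdifferentiableAt_apply hX) (hJ.mdifferentiableAt_apply hY)]
    simp only [map_add, add_apply]
    module

lemma covDeriv_apply (hJ : IsAlmostHermitian J) (hX : MDiffAt (T% X) x) (u : TangentSpace I x) :
    covDeriv (fun y => J y (X y)) x u = J x (covDeriv X x u) + covDerivEnd J x u (X x) := by
  have h := (hJ.tensorialAt_covDerivEnd u).pointwise hX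
    (mdifferentiableAt_extend I E (X x)) (by simp)
  rw [covDerivEnd, ← h]
  abel

lemma covDerivEnd_map (hJ : IsAlmostHermitian J) (u v : TangentSpace I x) :
    covDerivEnd J x u (J x v) = -J x (covDerivEnd J x u v) := by
  have hX : MDiffAt (T% (extend E v)) x := mdifferentiableAt_extend I E v
  have h1 := hJ.covDeriv_apply (hJ.mdifferentiableAt_apply hX) u
  rw [hJ.covDeriv_apply hX, show (fun y => J y (J y (extend E v y)))
    = fun y => -extend E v y from funext fun y => hJ.sq y _, covDeriv_neg hX] at h1
  simp only [map_add, hJ.sq, extend_apply_self, neg_apply] at h1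
  rw [eq_neg_iff_add_eq_zero, add_comm]
  simpa [add_assoc] using h1

/-- The covariant derivative of `J` as a bilinear map. -/
def covDerivEndₗ (hJ : IsAlmostHermitian J) (x : M) :
    TangentSpace I x →ₗ[ℝ] TangentSpace I x →ₗ[ℝ] TangentSpace I x :=
  LinearMap.mk₂ ℝ (covDerivEnd J x)
    (fun u u' v => by simp only [covDerivEnd, map_add]; abel)
    (fun c u v => by simp only [covDerivEnd, map_smul, smul_sub])
    (fun u v v' => by
      have hv : MDiffAt (T% (extend E v)) x := mdifferentiableAt_extend I E v
      have hv' : MDiffAt (T% (extend E v')) x := mdifferentiableAt_extend I E v'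
      have h := (hJ.tensorialAt_covDerivEnd u).add hv hv'
      rw [(hJ.tensorialAt_covDerivEnd u).pointwise (mdifferentiableAt_add_section hv hv')
        (mdifferentiableAt_extend I E (v + v')) (by simp)] at h
      exact h)
    (fun c u v => by
      have hv : MDiffAt (T% (extend E v)) x := mdifferentiableAt_extend I E v
      have hc : MDiffAt (fun _ : M => c) x := mdifferentiableAt_const
      have h := (hJ.tensorialAt_covDerivEnd u).smul hc hv
      rw [(hJ.tensorialAt_covDerivEnd u).pointwise (hc.smul_section hv)
        (mdifferentiableAt_extend I E (c • v)) (by simp)] at h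
      exact h)

lemma covDerivEndₗ_apply (hJ : IsAlmostHermitian J) (u v : TangentSpace I x) :
    hJ.covDerivEndₗ x u v = covDerivEnd J x u v := rfl

lemma covDerivEnd_smul_left (hJ : IsAlmostHermitian J) (c : ℝ) (u v : TangentSpace I x) :
    covDerivEnd J x (c • u) v = c • covDerivEnd J x u v := by
  simp [← hJ.covDerivEndₗ_apply]

lemma covDerivEnd_neg_left (hJ : IsAlmostHermitian J) (u v : TangentSpace I x) :
    covDerivEnd J x (-u) v = -covDerivEnd J x u v := by
  simp [← hJ.covDerivEndₗ_apply]

lemma tensorD_map (hJ : IsAlmostHermitian J) (Y : Π x : M, TangentSpace I x)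
    (v : TangentSpace I x) : tensorD J Y x (J x v) = J x (tensorD J Y x v) := by
  simp [tensorD, hJ.sq, add_comm]

end IsAlmostHermitian

/-! ### Traces -/

/-- The metric trace of a bilinear map may be computed in any orthonormal basis. -/
lemma metricTrace_eq_sum {ι : Type*} [Fintype ι]
    (B : TangentSpace I x →ₗ[ℝ] TangentSpace I x →ₗ[ℝ] TangentSpace I x)
    (b : OrthonormalBasis ι ℝ (TangentSpace I x)) :
    metricTrace x (fun u v => B u v) = ∑ i, B (b i) (b i) := by
  classical
  set s := stdOrthonormalBasis ℝ (TangentSpace I x)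
  have h (i) : B (s i) (s i)
      = ∑ a, ∑ c, ((inner ℝ (b a) (s i) : ℝ) * inner ℝ (s i) (b c)) • B (b a) (b c) := by
    conv_lhs => rw [← b.sum_repr' (s i)]
    simp only [map_sum, LinearMap.sum_apply, map_smul, LinearMap.smul_apply, Finset.smul_sum,
      smul_smul]
    rw [Finset.sum_comm]
    refine Finset.sum_congr rfl fun a _ => Finset.sum_congr rfl fun c _ => ?_
    rw [real_inner_comm (b c), mul_comm]
  have hd (a c) : ∑ i, (inner ℝ (b a) (s i) : ℝ) * inner ℝ (s i) (b c) = if a = c then 1 else 0 := by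
    rw [s.sum_inner_mul_inner]
    exact orthonormal_iff_ite.1 b.orthonormal a c
  calc metricTrace x (fun u v => B u v) = ∑ i, B (s i) (s i) := rfl
    _ = ∑ a, ∑ c, (∑ i, (inner ℝ (b a) (s i) : ℝ) * inner ℝ (s i) (b c)) • B (b a) (b c) := by
      simp only [h, Finset.sum_smul]
      rw [Finset.sum_comm]
      exact Finset.sum_congr rfl fun a _ => Finset.sum_comm
    _ = ∑ a, B (b a) (b a) := by simp [hd]

namespace IsHermitianFrameOn

variable {n : ℕ} {e : Fin n → Π x : M, TangentSpace I x}

lemma metricTrace_eq (he : IsHermitianFrameOn J e U) (hx : x ∈ U)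
    (B : TangentSpace I x →ₗ[ℝ] TangentSpace I x →ₗ[ℝ] TangentSpace I x) :
    metricTrace x (fun u v => B u v)
      = ∑ j, (B (e j x) (e j x) + B (J x (e j x)) (J x (e j x))) := by
  rw [metricTrace_eq_sum B (he.basis hx), Fintype.sum_sum_type, ← Finset.sum_add_distrib]
  simp only [basis_inl, basis_inr]

lemma contMDiffOn_covDerivEnd (hJ : IsAlmostHermitian J) (he : IsHermitianFrameOn J e U)
    (hX : CMDiff[U] ∞ (T% X)) (hV : CMDiff[U] ∞ (T% V)) :
    CMDiff[U] ∞ (T% (fun y => covDerivEnd J y (V y) (X y))) := by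
  have h := (he.contMDiffOn_covDeriv hJ (hJ.contMDiffOn_apply hX) hV).sub_section
    (hJ.contMDiffOn_apply (he.contMDiffOn_covDeriv hJ hX hV))
  refine h.congr fun y hy => ?_
  simp [hJ.covDeriv_apply (mdifferentiableAt_of_contMDiffOn he.isOpen hX hy)]

lemma contMDiffOn_sigmaField (hJ : IsAlmostHermitian J) (he : IsHermitianFrameOn J e U) :
    CMDiff[U] ∞ (T% (sigmaField J)) := by
  refine hJ.contMDiffOn_apply ?_
  have h : CMDiff[U] ∞ (T% (fun y => ∑ j, (covDerivEnd J y (e j y) (e j y)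
      + covDerivEnd J y (J y (e j y)) (J y (e j y))))) := by
    refine ContMDiffOn.sum_section fun j _ => ?_
    have hj := hJ.contMDiffOn_apply (he.smooth j)
    exact (he.contMDiffOn_covDerivEnd hJ (he.smooth j) (he.smooth j)).add_section
      (he.contMDiffOn_covDerivEnd hJ hj hj)
  refine h.congr fun y hy => ?_
  exact congrArg (fun v => (⟨y, v⟩ : TangentBundle I M))
    (he.metricTrace_eq hy (hJ.covDerivEndₗ y))

lemma contMDiffOn_tensorD (hJ : IsAlmostHermitian J) (he : IsHermitianFrameOn J e U)
    (hX : CMDiff[U] ∞ (T% X)) (hV : CMDiff[U] ∞ (T% V)) :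
    CMDiff[U] ∞ (T% (fun y => tensorD J X y (V y))) :=
  (he.contMDiffOn_covDeriv hJ hX (hJ.contMDiffOn_apply hV)).add_section
    (hJ.contMDiffOn_apply (he.contMDiffOn_covDeriv hJ hX hV))

end IsHermitianFrameOn

lemma IsAlmostHermitian.mdifferentiableAt_sigmaField (hJ : IsAlmostHermitian J) (x : M) :
    MDiffAt (T% (sigmaField J)) x := by
  obtain ⟨n, e, U, hx, he⟩ := hJ.exists_hermitianFrame x
  exact mdifferentiableAt_of_contMDiffOn he.isOpen (he.contMDiffOn_sigmaField hJ) hx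

/-! ### The first condition -/

lemma lieDerivMetric_eq (hY : MDiffAt (T% Y) x) (u v : TangentSpace I x) :
    lieDerivMetric Y x u v = inner ℝ (covDeriv Y x u) v + inner ℝ u (covDeriv Y x v) := by
  have hu : MDiffAt (T% (extend E u)) x := mdifferentiableAt_extend I E u
  have hv : MDiffAt (T% (extend E v)) x := mdifferentiableAt_extend I E v
  have h1 := (CovariantDerivative.torsion_eq_zero_iff _).1
    (LeviCivita.torsion_eq_zero (I := I) (M := M)) hY hu
  have h2 := (CovariantDerivative.torsion_eq_zero_iff _).1
    (LeviCivita.torsion_eq_zero (I := I) (M := M)) hY hv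
  have h3 := LeviCivita.d_inner_eq hu hv (Y x)
  simp only [extend_apply_self] at h1 h2 h3
  rw [lieDerivMetric, ← h1, ← h2, inner_sub_left, inner_sub_right]
  unfold LeviCivita.ip at h3
  rw [h3]
  simp only [covDeriv]
  ring

lemma covC_toC (Y : Π x : M, TangentSpace I x) (x : M) (Z : CTangent I x) :
    covC (fun y => toC (Y y)) x Z = (covDeriv Y x Z.1, covDeriv Y x Z.2) := by
  simp [covC, toC, covDeriv_zero]

lemma IsAlmostHermitian.memHol_iff (hJ : IsAlmostHermitian J) (Z : CTangent I x) :
    MemHol J Z ↔ Z = (Z.1, -J x Z.1) := by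
  constructor
  · intro h
    have h1 : J x Z.1 = -Z.2 := congrArg Prod.fst h
    exact Prod.ext rfl (by simp [h1])
  · intro h
    rw [h]
    simp [MemHol, mapC, mulI, hJ.sq]

lemma IsAlmostHermitian.complexCondOne_iff (hJ : IsAlmostHermitian J) (x : M) :
    ComplexCondOne J x ↔ RealCondOne J x := by
  have hσ := hJ.mdifferentiableAt_sigmaField x
  simp only [RealCondOne, lieDerivMetric_eq hσ, flat]
  constructor
  · intro h u v
    have := congrArg Complex.re (h (u, -J x u) (v, -J x v)
      ((hJ.memHol_iff _).2 rfl) ((hJ.memHol_iff _).2 rfl))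
    simp only [covC_toC, gC] at this
    simp only [toC, Complex.add_re, Complex.mul_re, map_neg, inner_neg_left,
      inner_neg_right, inner_zero_left] at this
    rw [real_inner_comm _ u, real_inner_comm _ (J x u)]
    linarith
  · intro h Z W hZ hW
    rw [hJ.memHol_iff] at hZ hW
    rw [hZ, hW]
    generalize Z.1 = u
    generalize W.1 = v
    have h1 := h u v
    have h2 := h (J x u) v
    rw [real_inner_comm _ u, real_inner_comm _ (J x u)] at h1
    simp only [hJ.sq, map_neg, inner_neg_left, inner_neg_right] at h2
    rw [real_inner_comm _ u, real_inner_comm _ (J x u)] at h2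
    simp only [covC_toC, gC]
    simp only [toC]
    apply Complex.ext
    · simp only [Complex.add_re, Complex.mul_re, map_neg, inner_neg_left,
        inner_neg_right, inner_zero_left]
      linarith
    · simp only [Complex.add_im, Complex.mul_im, map_neg, inner_neg_left,
        inner_neg_right, inner_zero_left]
      linarith

/-! ### The second condition -/

/-- The real linear map `(a, b) ↦ a + J b`, whose kernel is `T''M`. -/
def holRe (J : Π x : M, TangentSpace I x →L[ℝ] TangentSpace I x) (x : M) :
    CTangent I x →ₗ[ℝ] TangentSpace I x :=
  (LinearMap.fst ℝ _ _) + (J x : TangentSpace I x →ₗ[ℝ] TangentSpace I x) ∘ₗ LinearMap.snd ℝ _ _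

lemma holRe_apply (Z : CTangent I x) : holRe J x Z = Z.1 + J x Z.2 := rfl

namespace IsAlmostHermitian

lemma holPart_eq_zero_iff (hJ : IsAlmostHermitian J) (Z : CTangent I x) :
    holPart J Z = 0 ↔ holRe J x Z = 0 := by
  rw [holPart, smul_eq_zero_iff_right (by norm_num), holRe_apply]
  constructor
  · intro h
    simpa [mulI, mapC] using congrArg Prod.fst h
  · intro h
    refine Prod.ext (by simpa [mulI, mapC] using h) ?_
    have := congrArg (J x) h
    simp only [map_add, hJ.sq, map_zero] at this
    simp only [mulI, mapC, Prod.snd_sub, Prod.snd_zero]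
    rw [← neg_eq_zero, neg_sub, sub_eq_add_neg]
    exact this

lemma holRe_covC_conj (hJ : IsAlmostHermitian J) (c : ℝ) (hX : MDiffAt (T% X) x)
    (Z : CTangent I x) :
    holRe J x (covC (fun y => ((c • X y, c • J y (X y)) : CTangent I y)) x Z)
      = c • (J x (covDerivEnd J x Z.1 (X x)) - covDerivEnd J x Z.2 (X x)) := by
  simp only [holRe_apply, covC, covDeriv_const_smul c hX,
    covDeriv_const_smul c (hJ.mdifferentiableAt_apply hX), smul_apply,
    hJ.covDeriv_apply hX, map_add, map_smul, hJ.sq]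
  module

lemma holRe_covC_anti (hJ : IsAlmostHermitian J) (c : ℝ) (hV : MDiffAt (T% V) x)
    (Z : CTangent I x) :
    holRe J x (covC (fun y => ((c • -J y (V y), c • V y) : CTangent I y)) x Z)
      = -c • (covDerivEnd J x Z.1 (V x) + J x (covDerivEnd J x Z.2 (V x))) := by
  have hJV := hJ.mdifferentiableAt_apply hV
  have h := covDeriv_const_smul (-c) hJV
  simp only [neg_smul, ← smul_neg] at h
  simp only [holRe_apply, covC, covDeriv_const_smul c hV, h, smul_apply,
    neg_apply, hJ.covDeriv_apply hV, map_add, map_smul, map_neg, hJ.sq]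
  module

end IsAlmostHermitian

lemma antiPart_covC_conjC (hJ : IsAlmostHermitian J) (Y : Π x : M, TangentSpace I x) (c : ℝ)
    (v : TangentSpace I x) :
    antiPart J (covC (fun y => toC (Y y)) x (conjC (c • ((v, -J x v) : CTangent I x))))
      = ((c / 2) • -J x (tensorD J Y x v), (c / 2) • tensorD J Y x v) := by
  rw [covC_toC]
  simp only [antiPart, conjC, mulI, mapC, tensorD, Prod.smul_mk, smul_neg, neg_neg, map_smul,
    add_apply, ContinuousLinearMap.comp_apply, Prod.mk_add_mk, map_add, hJ.sq]
  congr 1 <;> module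

lemma holPart_covC (hJ : IsAlmostHermitian J) (Y : Π x : M, TangentSpace I x) (c : ℝ)
    (v : TangentSpace I x) :
    holPart J (covC (fun y => toC (Y y)) x (c • ((v, -J x v) : CTangent I x)))
      = ((c / 2) • -J x (tensorD J Y x v), (c / 2) • -tensorD J Y x v) := by
  rw [covC_toC]
  simp only [holPart, mulI, mapC, tensorD, Prod.smul_mk, smul_neg, map_smul, map_neg,
    add_apply, ContinuousLinearMap.comp_apply, Prod.mk_sub_mk, map_add, hJ.sq]
  congr 1 <;> module

/-- The contribution of one field of a Hermitian frame to the second condition. -/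
lemma IsHermitianFrameOn.holRe_frame_term {n : ℕ} {e : Fin n → Π x : M, TangentSpace I x}
    (hJ : IsAlmostHermitian J) (he : IsHermitianFrameOn J e U) (hx : x ∈ U) (j : Fin n) :
    holRe J x (covC (fun y => antiPart J (covC (fun y => toC (sigmaField J y)) y
          (conjC (frameZ J e j y)))) x (frameZ J e j x)
        + covC (fun y => conjC (frameZ J e j y)) x
            (holPart J (covC (fun y => toC (sigmaField J y)) x (frameZ J e j x))))
      = (1 / 4 : ℝ) • (-covDerivEnd J x (e j x) (tensorD J (sigmaField J) x (e j x))
          + J x (covDerivEnd J x (J x (e j x)) (tensorD J (sigmaField J) x (e j x)))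
          + covDerivEnd J x (tensorD J (sigmaField J) x (e j x)) (e j x)
          - J x (covDerivEnd J x (J x (tensorD J (sigmaField J) x (e j x))) (e j x))) := by
  have hV : MDiffAt (T% (fun y => tensorD J (sigmaField J) y (e j y))) x :=
    mdifferentiableAt_of_contMDiffOn he.isOpen
      (he.contMDiffOn_tensorD hJ (he.contMDiffOn_sigmaField hJ) (he.smooth j)) hx
  have hej := mdifferentiableAt_of_contMDiffOn he.isOpen (he.smooth j) hx
  have hc : (1 / √2 : ℝ) * (1 / √2) = 1 / 2 := by
    rw [div_mul_div_comm, Real.mul_self_sqrt (by norm_num)]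
    norm_num
  simp only [frameZ, antiPart_covC_conjC hJ, holPart_covC hJ]
  generalize (1 / √2 : ℝ) = c at hc
  have hconj : (fun y => conjC (c • ((e j y, -J y (e j y)) : CTangent I y)))
      = fun y => (c • e j y, c • J y (e j y)) := by
    funext y
    simp [conjC]
  rw [hconj, map_add, hJ.holRe_covC_anti _ hV, hJ.holRe_covC_conj _ hej]
  simp only [Prod.smul_mk, hJ.covDerivEnd_smul_left, hJ.covDerivEnd_neg_left, map_smul, map_neg,
    smul_neg, smul_add, smul_sub, smul_smul, neg_mul, neg_smul]
  have h1 : c / 2 * c = 1 / 4 := by linarith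
  have h2 : c * (c / 2) = 1 / 4 := by linarith
  rw [h1, h2]
  module

lemma IsHermitianFrameOn.complexCondTwo_iff {n : ℕ} {e : Fin n → Π x : M, TangentSpace I x}
    (hJ : IsAlmostHermitian J) (he : IsHermitianFrameOn J e U) (hx : x ∈ U) :
    ComplexCondTwo J e x ↔ RealCondTwo J x := by
  have hσ := hJ.mdifferentiableAt_sigmaField x
  have h3 : (fun y => antiPart J (toC (sigmaField J y)))
      = fun y => ((1 / 2 : ℝ) • sigmaField J y, (1 / 2 : ℝ) • J y (sigmaField J y)) := by
    funext y
    simp [antiPart, toC, mulI, mapC]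
  have h4 : holPart J (toC (sigmaField J x))
      = ((1 / 2 : ℝ) • sigmaField J x, (1 / 2 : ℝ) • -J x (sigmaField J x)) := by
    simp [holPart, toC, mulI, mapC]
  let D : TangentSpace I x →ₗ[ℝ] TangentSpace I x := (tensorD J (sigmaField J) x : _ →L[ℝ] _)
  have htr := he.metricTrace_eq hx
    ((hJ.covDerivEndₗ x).compl₂ D - (hJ.covDerivEndₗ x) ∘ₗ D)
  simp only [LinearMap.sub_apply, LinearMap.compl₂_apply, LinearMap.comp_apply, D,
    hJ.covDerivEndₗ_apply, ContinuousLinearMap.coe_coe, hJ.tensorD_map, hJ.covDerivEnd_map] at htr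
  rw [ComplexCondTwo, hJ.holPart_eq_zero_iff, RealCondTwo]
  dsimp only
  rw [htr, map_sub, map_smul, map_sub, map_sum, h3, h4, hJ.holRe_covC_conj _ hσ]
  simp only [he.holRe_frame_term hJ hx]
  rw [holRe_apply, ← Finset.smul_sum]
  simp only [toC, map_zero, add_zero, hJ.covDerivEnd_smul_left, hJ.covDerivEnd_neg_left,
    hJ.covDerivEnd_map]
  have hs : ∑ j, (covDerivEnd J x (e j x) (tensorD J (sigmaField J) x (e j x))
        - covDerivEnd J x (tensorD J (sigmaField J) x (e j x)) (e j x)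
        + (-J x (covDerivEnd J x (J x (e j x)) (tensorD J (sigmaField J) x (e j x)))
          - -J x (covDerivEnd J x (J x (tensorD J (sigmaField J) x (e j x))) (e j x))))
      = -∑ j, (-covDerivEnd J x (e j x) (tensorD J (sigmaField J) x (e j x))
          + J x (covDerivEnd J x (J x (e j x)) (tensorD J (sigmaField J) x (e j x)))
          + covDerivEnd J x (tensorD J (sigmaField J) x (e j x)) (e j x)
          - J x (covDerivEnd J x (J x (tensorD J (sigmaField J) x (e j x))) (e j x))) := by
    rw [← Finset.sum_neg_distrib]
    exact Finset.sum_congr rfl fun j _ => by abel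
  rw [hs]
  generalize (∑ j, (-covDerivEnd J x (e j x) (tensorD J (sigmaField J) x (e j x))
          + J x (covDerivEnd J x (J x (e j x)) (tensorD J (sigmaField J) x (e j x)))
          + covDerivEnd J x (tensorD J (sigmaField J) x (e j x)) (e j x)
          - J x (covDerivEnd J x (J x (tensorD J (sigmaField J) x (e j x))) (e j x)))) = S
  simp only [map_add, map_smul, map_neg, hJ.sq]
  refine Eq.congr ?_ rfl
  module

end AlmostHermitian

theorem corollary1
    {E : Type*} [NormedAddCommGroup E] [NormedSpace ℝ E] [FiniteDimensional ℝ E]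
    {H : Type*} [TopologicalSpace H] {I : ModelWithCorners ℝ E H}
    {M : Type*} [TopologicalSpace M] [ChartedSpace H M] [IsManifold I ∞ M]
    [BoundarylessManifold I M]
    [RiemannianBundle (fun x : M => TangentSpace I x)]
    [IsContMDiffRiemannianBundle I ∞ E (fun x : M => TangentSpace I x)]
    (J : Π x : M, TangentSpace I x →L[ℝ] TangentSpace I x) (hJ : IsAlmostHermitian J) :
    -- first condition: the complex and the real form are equivalent at every point
    (∀ x : M, ComplexCondOne J x ↔ RealCondOne J x) ∧
    -- second condition: the same, for every Hermitian frame near the point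
    (∀ (n : ℕ) (e : Fin n → Π x : M, TangentSpace I x) (U : Set M), IsHermitianFrameOn J e U →
      ∀ x ∈ U, (ComplexCondTwo J e x ↔ RealCondTwo J x)) ∧
    -- Hermitian frames exist near every point
    (∀ x : M, ∃ (n : ℕ) (e : Fin n → Π x : M, TangentSpace I x) (U : Set M),
      x ∈ U ∧ IsHermitianFrameOn J e U) ∧
    -- the tensor field `D^σ` is `J`-invariant
    (∀ (x : M) (X : TangentSpace I x),
      tensorD J (sigmaField J) x (J x X) = J x (tensorD J (sigmaField J) x X)) := by
  exact ⟨hJ.complexCondOne_iff, fun n e U he x hx => he.complexCondTwo_iff hJ hx,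
    hJ.exists_hermitianFrame, fun x X => hJ.tensorD_map _ X⟩
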